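/- Call a real polynomial $f\in\mathbb{R}[x]$ hyperbolic if all of its (complex) zeros are real; the zero polynomial is also regarded as hyperbolic. A linear operator $T:\mathbb{R}[x]\to\mathbb{R}[x]$ preserves hyperbolicity if $T[f]$ is hyperbolic whenever $f\in\mathbb{R}[x]$ is hyperbolic. Let $D=\frac{d}{dx}$, let $a,b,r_1,r_2,R\in\mathbb{R}$ with $a,b\ge 0$ and $r_1\neq r_2$. Then \[ R\in[0,ab] \] if and only if the operator \[ T=(x+r_1)(x+r_2)D^2+\bigl(b(x+r_1)+a(x+r_2)\bigr)D+R \] on $\mathbb{R}[x]$ preserves hyperbolicity. -/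

import Mathlib

open Polynomial

/-- A real polynomial is hyperbolic if all its complex zeros are real; the zero polynomial is
hyperbolic by convention. -/
def IsHyperbolic (f : ℝ[X]) : Prop :=
  f = 0 ∨ ∀ z : ℂ, aeval z f = 0 → z.im = 0

/-- A linear operator on real polynomials preserves hyperbolicity if it maps hyperbolic
polynomials to hyperbolic polynomials. -/
def PreservesHyperbolicity (T : ℝ[X] →ₗ[ℝ] ℝ[X]) : Prop :=
  ∀ f : ℝ[X], IsHyperbolic f → IsHyperbolic (T f)

/-- The differential operator `Q₂ D² + Q₁ D + Q₀` on real polynomials, with `D = d/dx`. -/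
noncomputable def secondOrderOp (Q₂ Q₁ Q₀ : ℝ[X]) : ℝ[X] →ₗ[ℝ] ℝ[X] :=
  LinearMap.mulLeft ℝ Q₂ ∘ₗ derivative ∘ₗ derivative
    + LinearMap.mulLeft ℝ Q₁ ∘ₗ derivative
    + LinearMap.mulLeft ℝ Q₀

/-! Sufficiency: at z in the open upper half-plane, f'/f = e₁ and f''/f = 2e₂ for points y = 1/(z -
s) of the open lower half-plane, s the zeros of f. Put u = a/(z + r₁), v = b/(z + r₂), R = t·ab with
t ∈ [0,1]. Then Tf(z) = 0 reads 2e₂ + (u + v)e₁ + tuv = 0, that is v = -(2e₂ + ue₁)/(e₁ + tu). By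
`im_symm_quotient_neg` the right side has positive imaginary part, but Im v ≤ 0.

Necessity: test polynomials whose images, after removing a power or differentiating, are at most
quadratic and so have discriminant ≥ 0. Shifted powers of growing degree give R ≤ ab; (x + r₁)^j((x
+ r₁)² - M²) with M large excludes R < 0. -/

/-- The parallel sum of two points of the closed lower half-plane lies there too. -/
lemma im_mul_div_add_nonpos {u v : ℂ} (hu : u.im ≤ 0) (hv : v.im ≤ 0) :
    (u * v / (u + v)).im ≤ 0 := by
  have key : (u * v / (u + v)).im =
      (Complex.normSq u * v.im + Complex.normSq v * u.im) / Complex.normSq (u + v) := by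
    rw [Complex.div_im, ← sub_div]
    congr 1
    simp [Complex.normSq_apply]
    ring
  rw [key]
  apply div_nonpos_of_nonpos_of_nonneg _ (Complex.normSq_nonneg _)
  have := mul_nonneg (Complex.normSq_nonneg u) (neg_nonneg.2 hv)
  have := mul_nonneg (Complex.normSq_nonneg v) (neg_nonneg.2 hu)
  linarith

/-- The parallel sum of two points of the open lower half-plane lies there too. -/
lemma im_mul_div_add_neg {u v : ℂ} (hu : u.im < 0) (hv : v.im < 0) :
    (u * v / (u + v)).im < 0 := by
  have key : (u * v / (u + v)).im =
      (Complex.normSq u * v.im + Complex.normSq v * u.im) / Complex.normSq (u + v) := by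
    rw [Complex.div_im, ← sub_div]
    congr 1
    simp [Complex.normSq_apply]
    ring
  have hne : ∀ w : ℂ, w.im < 0 → 0 < Complex.normSq w := fun w hw =>
    Complex.normSq_pos.2 (by rintro rfl; simp at hw)
  rw [key]
  apply div_neg_of_neg_of_pos _ (hne _ (by simp; linarith))
  have := mul_pos (hne u hu) (neg_pos.2 hv)
  have := mul_pos (hne v hv) (neg_pos.2 hu)
  linarith

lemma Multiset.im_sum_neg {Y : Multiset ℂ} (hY : ∀ y ∈ Y, y.im < 0) (h0 : Y ≠ 0) :
    Y.sum.im < 0 := by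
  induction Y using Multiset.induction_on with
  | empty => exact absurd rfl h0
  | cons y Y ih =>
    have hy := hY y (by simp)
    rcases eq_or_ne Y 0 with rfl | hne
    · simpa using hy
    · have := ih (fun w hw => hY w (by simp [hw])) hne
      simp
      linarith

lemma Multiset.sum_map_mul_sub_div (Y : Multiset ℂ) (s : ℂ) (hs : s ≠ 0) :
    (Y.map fun y => y * (s - y) / s).sum = Y.sum - (Y.map fun y => y ^ 2).sum / s := by
  induction Y using Multiset.induction_on with
  | empty => simp
  | cons y Y ih =>
    simp only [Multiset.map_cons, Multiset.sum_cons, ih]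
    field_simp
    ring

/-- For at least two points `y` in the open lower half-plane, with elementary symmetric functions
`e₁`, `e₂`, the quotient `(2 e₂ + u e₁) / (e₁ + t u)` lies in the open lower half-plane. -/
lemma im_symm_quotient_neg {Y : Multiset ℂ} (hY : ∀ y ∈ Y, y.im < 0) (hcard : 2 ≤ Y.card)
    {u : ℂ} (hu : u.im ≤ 0) {t : ℝ} (ht0 : 0 ≤ t) (ht1 : t ≤ 1) :
    ((Y.sum ^ 2 - (Y.map fun y => y ^ 2).sum + u * Y.sum) / (Y.sum + t * u)).im < 0 := by
  have hY0 : Y ≠ 0 := by rintro rfl; simp at hcard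
  have he := Multiset.im_sum_neg hY hY0
  have htu : ((t : ℂ) * u).im ≤ 0 := by
    simpa using mul_nonpos_of_nonneg_of_nonpos ht0 hu
  set s : ℂ := Y.sum + t * u with hs
  have hsim : s.im < 0 := by rw [hs, Complex.add_im]; linarith
  have hs0 : s ≠ 0 := by rintro h; simp [h] at hsim
  -- Each summand is the parallel sum of y and s - y; t times the last quotient is that of tu and
  -- e₁. The bound t ≤ 1 is what makes the last coefficient nonnegative.
  have hsplit : (Y.sum ^ 2 - (Y.map fun y => y ^ 2).sum + u * Y.sum) / s =
      (Y.map fun y => y * (s - y) / s).sum + ((1 - t : ℝ) : ℂ) * (u * Y.sum / s) := by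
    rw [Multiset.sum_map_mul_sub_div Y s hs0]
    field_simp
    rw [hs]
    push_cast
    ring
  have h1 : (Y.map fun y => y * (s - y) / s).sum.im < 0 := by
    apply Multiset.im_sum_neg
    · intro w hw
      obtain ⟨y, hy, rfl⟩ := Multiset.mem_map.1 hw
      -- With two points or more, s - y still contains some point of the open half-plane.
      obtain ⟨Y', rfl⟩ := Multiset.exists_cons_of_mem hy
      have hY' : Y' ≠ 0 := by rintro rfl; simp at hcard
      have h' := Multiset.im_sum_neg (fun w hw => hY w (by simp [hw])) hY'
      have := im_mul_div_add_neg (hY y hy) (v := s - y) (by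
        rw [hs]
        simp only [Multiset.sum_cons, Complex.add_im, Complex.sub_im]
        linarith)
      simpa using this
    · simpa using hY0
  have h2 : (u * Y.sum / s).im ≤ 0 := by
    rcases ht0.eq_or_lt with rfl | ht
    · have : Y.sum ≠ 0 := by rintro h; simp [h] at he
      simpa [hs, this] using hu
    · have h := im_mul_div_add_nonpos htu he.le
      rw [add_comm ((t : ℂ) * u), ← hs, mul_assoc, mul_div_assoc, Complex.im_ofReal_mul] at h
      exact nonpos_of_mul_nonpos_right h ht
  rw [hsplit, Complex.add_im, Complex.im_ofReal_mul]
  have := mul_nonpos_of_nonneg_of_nonpos (sub_nonneg.2 ht1) h2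
  linarith

/-! ### Logarithmic derivatives -/

lemma eval_derivative_prod_X_sub_C (S : Multiset ℂ) (z : ℂ) (hz : ∀ s ∈ S, z - s ≠ 0) :
    (derivative (S.map fun s => X - C s).prod).eval z =
      ((S.map fun s => X - C s).prod).eval z * (S.map fun s => (z - s)⁻¹).sum := by
  induction S using Multiset.induction_on with
  | empty => simp
  | cons s S ih =>
    have hs := hz s (by simp)
    simp only [Multiset.map_cons, Multiset.prod_cons, Multiset.sum_cons, derivative_mul,
      derivative_sub, derivative_X, derivative_C, eval_add, eval_mul, eval_sub, eval_X, eval_C,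
      eval_one, eval_zero, ih fun w hw => hz w (by simp [hw])]
    field_simp
    ring

lemma eval_derivative_derivative_prod_X_sub_C (S : Multiset ℂ) (z : ℂ)
    (hz : ∀ s ∈ S, z - s ≠ 0) :
    (derivative (derivative (S.map fun s => X - C s).prod)).eval z =
      ((S.map fun s => X - C s).prod).eval z *
        ((S.map fun s => (z - s)⁻¹).sum ^ 2 -
          ((S.map fun s => (z - s)⁻¹).map fun y => y ^ 2).sum) := by
  induction S using Multiset.induction_on with
  | empty => simp
  | cons s S ih =>
    have hs := hz s (by simp)
    have hS : ∀ w ∈ S, z - w ≠ 0 := fun w hw => hz w (by simp [hw])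
    simp only [Multiset.map_cons, Multiset.prod_cons, Multiset.sum_cons, derivative_mul,
      derivative_sub, derivative_X, derivative_C, derivative_add, derivative_one, derivative_zero,
      eval_add, eval_mul, eval_sub, eval_X, eval_C,
      eval_one, eval_zero, ih hS, eval_derivative_prod_X_sub_C S z hS]
    field_simp
    ring

lemma isHyperbolic_of_aeval_ne_zero {f : ℝ[X]} (h : ∀ z : ℂ, 0 < z.im → aeval z f ≠ 0) :
    IsHyperbolic f := by
  right
  intro z hz
  rcases lt_trichotomy z.im 0 with h0 | h0 | h0
  · refine absurd ?_ (h (starRingEnd ℂ z) (by simpa using h0))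
    rw [Polynomial.aeval_conj, hz, map_zero]
  · exact h0
  · exact absurd hz (h z h0)

/-- Values of a nonzero hyperbolic polynomial and of its first two derivatives in the open upper
half-plane, in terms of points of the open lower half-plane. -/
lemma IsHyperbolic.exists_log_derivatives {f : ℝ[X]} (hf : IsHyperbolic f) (h0 : f ≠ 0) {z : ℂ}
    (hz : 0 < z.im) :
    aeval z f ≠ 0 ∧ ∃ Y : Multiset ℂ, Y.card = f.natDegree ∧ (∀ y ∈ Y, y.im < 0) ∧
      aeval z (derivative f) = aeval z f * Y.sum ∧
      aeval z (derivative (derivative f)) =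
        aeval z f * (Y.sum ^ 2 - (Y.map fun y => y ^ 2).sum) := by
  have hroot := hf.resolve_left h0
  refine ⟨fun h => hz.ne' (hroot z h), ?_⟩
  set g : ℂ[X] := f.map (algebraMap ℝ ℂ) with hg
  have hg0 : g ≠ 0 := (Polynomial.map_ne_zero_iff (algebraMap ℝ ℂ).injective).2 h0
  have hsplit : g.Splits := IsAlgClosed.splits g
  have hprod : g = C g.leadingCoeff * (g.roots.map fun s => X - C s).prod :=
    hsplit.eq_prod_roots
  have him : ∀ s ∈ g.roots, s.im = 0 := by
    intro s hs
    apply hroot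
    rw [mem_roots hg0, IsRoot.def, hg, eval_map_algebraMap] at hs
    exact hs
  have hzs : ∀ s ∈ g.roots, z - s ≠ 0 := by
    intro s hs h
    rw [sub_eq_zero.1 h, him s hs] at hz
    exact lt_irrefl _ hz
  have hev : ∀ k : ℝ[X], aeval z k = (k.map (algebraMap ℝ ℂ)).eval z := fun k =>
    (eval_map_algebraMap k z).symm
  refine ⟨g.roots.map fun s => (z - s)⁻¹, ?_, ?_, ?_, ?_⟩
  · rw [Multiset.card_map, ← hsplit.natDegree_eq_card_roots, hg, natDegree_map]
  · intro y hy
    obtain ⟨s, hs, rfl⟩ := Multiset.mem_map.1 hy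
    rw [Complex.inv_im]
    apply div_neg_of_neg_of_pos _ (Complex.normSq_pos.2 (hzs s hs))
    simpa [him s hs] using hz
  · rw [hev, hev, ← derivative_map, ← hg]
    conv_lhs => rw [hprod]
    conv_rhs => enter [1]; rw [hprod]
    rw [derivative_C_mul, eval_C_mul, eval_C_mul, eval_derivative_prod_X_sub_C _ _ hzs, mul_assoc]
  · rw [hev, hev, ← derivative_map, ← derivative_map, ← hg]
    conv_lhs => rw [hprod]
    conv_rhs => enter [1]; rw [hprod]
    rw [derivative_C_mul, derivative_C_mul, eval_C_mul, eval_C_mul,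
      eval_derivative_derivative_prod_X_sub_C _ _ hzs, mul_assoc]

/-! ### Sufficiency -/

lemma isHyperbolic_C_mul_X_add_C (α β : ℝ) : IsHyperbolic (C α * X + C β) := by
  by_cases hα : α = 0
  · by_cases hβ : β = 0
    · left; simp [hα, hβ]
    · right; intro z hz; simp [hα, hβ] at hz
  · right
    intro z hz
    have := congrArg Complex.im hz
    simpa [hα] using this

lemma secondOrderOp_apply (P Q S f : ℝ[X]) :
    secondOrderOp P Q S f = P * derivative (derivative f) + Q * derivative f + S * f := by
  simp [secondOrderOp]

lemma im_ofReal_div_nonpos {a : ℝ} (ha : 0 ≤ a) {p : ℂ} (hp : 0 < p.im) :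
    ((a : ℂ) / p).im ≤ 0 := by
  rw [div_eq_mul_inv, Complex.im_ofReal_mul, Complex.inv_im]
  exact mul_nonpos_of_nonneg_of_nonpos ha
    (div_nonpos_of_nonpos_of_nonneg (by linarith) (Complex.normSq_nonneg _))

theorem preservesHyperbolicity_of_mem_Icc {a b R : ℝ} (r₁ r₂ : ℝ) (ha : 0 ≤ a) (hb : 0 ≤ b)
    (hR : R ∈ Set.Icc 0 (a * b)) :
    PreservesHyperbolicity
        (secondOrderOp ((X + C r₁) * (X + C r₂))
          (C b * (X + C r₁) + C a * (X + C r₂)) (C R)) := by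
  intro f hf
  rw [secondOrderOp_apply]
  rcases eq_or_ne f 0 with rfl | hf0
  · left; simp
  -- The half-plane estimate needs two zeros; in lower degree the image has degree at most one.
  rcases lt_or_ge f.natDegree 2 with hdeg | hdeg
  · obtain ⟨α, β, rfl⟩ := exists_eq_X_add_C_of_natDegree_le_one (Nat.le_of_lt_succ hdeg)
    convert isHyperbolic_C_mul_X_add_C ((a + b + R) * α) ((b * r₁ + a * r₂) * α + R * β) using 1
    simp
    ring
  obtain ⟨t, ht0, ht1, rfl⟩ : ∃ t : ℝ, 0 ≤ t ∧ t ≤ 1 ∧ R = t * (a * b) := by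
    rcases (mul_nonneg ha hb).eq_or_lt with h | h
    · exact ⟨0, le_rfl, zero_le_one, by rw [← h] at hR; linarith [hR.1, hR.2]⟩
    · exact ⟨R / (a * b), div_nonneg hR.1 h.le, (div_le_one h).2 hR.2,
        (div_mul_cancel₀ R h.ne').symm⟩
  apply isHyperbolic_of_aeval_ne_zero
  intro z hz hzero
  obtain ⟨hfz, Y, hcard, hY, h1, h2⟩ := hf.exists_log_derivatives hf0 hz
  have hp : 0 < (z + r₁).im := by simpa using hz
  have hq : 0 < (z + r₂).im := by simpa using hz
  have hp0 : z + r₁ ≠ 0 := by rintro h; simp [h] at hp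
  have hq0 : z + r₂ ≠ 0 := by rintro h; simp [h] at hq
  have hu := im_ofReal_div_nonpos ha hp
  have hv := im_ofReal_div_nonpos hb hq
  have hneg := im_symm_quotient_neg hY (hcard ▸ hdeg) hu ht0 ht1
  have hs0 : Y.sum + t * (a / (z + r₁)) ≠ 0 := by
    intro h
    simp [h] at hneg
  suffices h : (b : ℂ) / (z + r₂) =
      -((Y.sum ^ 2 - (Y.map fun y => y ^ 2).sum + a / (z + r₁) * Y.sum) /
        (Y.sum + t * (a / (z + r₁)))) by
    rw [h, Complex.neg_im] at hv
    linarith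
  rw [← neg_div, eq_div_iff hs0]
  simp only [map_add, map_mul, aeval_X, aeval_C, h1, h2, Complex.coe_algebraMap] at hzero
  have hfac : aeval z f * ((z + r₁) * (z + r₂) * (Y.sum ^ 2 - (Y.map fun y => y ^ 2).sum) +
      (b * (z + r₁) + a * (z + r₂)) * Y.sum + t * (a * b)) = 0 := by
    rw [← hzero]; ring
  have := (mul_eq_zero.1 hfac).resolve_left hfz
  field_simp
  linear_combination this

/-! ### Test polynomials and necessity -/

lemma discrim_nonneg_of_isHyperbolic {g : ℝ[X]} (hg : g ≠ 0) {r A B c : ℝ}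
    (h : IsHyperbolic (g * (C A * (X + C r) ^ 2 + C B * (X + C r) + C c))) :
    0 ≤ B ^ 2 - 4 * A * c := by
  by_contra! hneg
  have hA : A ≠ 0 := by rintro rfl; nlinarith [sq_nonneg B]
  rcases h with h | h
  · have hq := (mul_eq_zero.1 h).resolve_left hg
    have e0 := congrArg (eval (-r)) hq
    have e1 := congrArg (eval (1 - r)) hq
    have e2 := congrArg (eval (-1 - r)) hq
    simp at e0 e1 e2
    exact hA (by linarith)
  · set w : ℝ := √(4 * A * c - B ^ 2) with hw
    have hwpos : 0 < w := Real.sqrt_pos.2 (by linarith)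
    have hw2 : w ^ 2 = 4 * A * c - B ^ 2 := Real.sq_sqrt (by linarith)
    have hA' : (A : ℂ) ≠ 0 := by exact_mod_cast hA
    have hw2' : (w : ℂ) ^ 2 = 4 * A * c - B ^ 2 := by exact_mod_cast hw2
    have hz := h ((-B + w * Complex.I) / (2 * A) - r) (by
      simp only [map_add, map_mul, map_pow, aeval_X, aeval_C, Complex.coe_algebraMap]
      refine mul_eq_zero_of_right _ ?_
      field_simp
      ring_nf
      rw [Complex.I_sq, hw2']
      ring)
    have him : ((-B + w * Complex.I) / (2 * A) - r : ℂ).im = w / (2 * A) := by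
      have : ((-B + w * Complex.I) / (2 * A) - r : ℂ) =
          ((-B / (2 * A) - r : ℝ) : ℂ) + ((w / (2 * A) : ℝ) : ℂ) * Complex.I := by
        push_cast
        field_simp
        ring
      rw [this, Complex.add_im, Complex.ofReal_im, Complex.im_ofReal_mul, Complex.I_im]
      ring
    rw [him] at hz
    exact (div_ne_zero hwpos.ne' (mul_ne_zero two_ne_zero hA)) hz

lemma IsHyperbolic.mul {f g : ℝ[X]} (hf : IsHyperbolic f) (hg : IsHyperbolic g) :
    IsHyperbolic (f * g) := by
  rcases hf with rfl | hf
  · left; simp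
  rcases hg with rfl | hg
  · left; simp
  right
  intro z hz
  rw [map_mul, mul_eq_zero] at hz
  exact hz.elim (hf z) (hg z)

lemma isHyperbolic_X_add_C (r : ℝ) : IsHyperbolic (X + C r) := by
  simpa using isHyperbolic_C_mul_X_add_C 1 r

lemma IsHyperbolic.pow {f : ℝ[X]} (hf : IsHyperbolic f) (n : ℕ) : IsHyperbolic (f ^ n) := by
  induction n with
  | zero => simpa using isHyperbolic_C_mul_X_add_C 0 1
  | succ n ih => rw [pow_succ]; exact ih.mul hf

lemma IsHyperbolic.derivative {f : ℝ[X]} (hf : IsHyperbolic f) : IsHyperbolic (derivative f) := by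
  rcases eq_or_ne f 0 with rfl | hf0
  · left; simp
  rcases eq_or_ne f.natDegree 0 with hd | hd
  · left
    exact derivative_of_natDegree_zero hd
  apply isHyperbolic_of_aeval_ne_zero
  intro z hz
  obtain ⟨hfz, Y, hcard, hY, h1, -⟩ := hf.exists_log_derivatives hf0 hz
  rw [h1]
  refine mul_ne_zero hfz fun h => ?_
  have := Multiset.im_sum_neg hY (by rintro rfl; exact hd (by simpa using hcard.symm))
  simp [h] at this

lemma IsHyperbolic.iterate_derivative {f : ℝ[X]} (hf : IsHyperbolic f) (n : ℕ) :
    IsHyperbolic (Polynomial.derivative^[n] f) := by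
  induction n with
  | zero => exact hf
  | succ n ih => rw [Function.iterate_succ_apply']; exact ih.derivative

section Necessity

variable {a b r₁ r₂ R : ℝ}

/-- The image of (x + r₁ - c)^(m+2) is (x + r₁ - c)^m times a quadratic in x + r₁, whose
discriminant this is. -/
lemma discrim_nonneg_of_preserves
    (h : PreservesHyperbolicity (secondOrderOp ((X + C r₁) * (X + C r₂))
      (C b * (X + C r₁) + C a * (X + C r₂)) (C R))) (m : ℕ) (c : ℝ) :
    0 ≤ ((m + 2) * (m + 1) * (r₂ - r₁) + (m + 2) * (a * (r₂ - r₁) - (a + b) * c) - 2 * R * c) ^ 2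
      - 4 * ((m + 2) * (m + 1) + (m + 2) * (a + b) + R) *
        (-(m + 2) * a * (r₂ - r₁) * c + R * c ^ 2) := by
  have hf := h _ ((isHyperbolic_X_add_C (r₁ - c)).pow (m + 2))
  refine discrim_nonneg_of_isHyperbolic (r := r₁)
    (pow_ne_zero m (X_add_C_ne_zero (r₁ - c))) ?_
  convert hf using 1
  rw [secondOrderOp_apply]
  simp only [derivative_X_add_C_pow, derivative_mul, derivative_C, Nat.add_sub_cancel,
    show m + 2 - 1 = m + 1 by omega]
  simp only [map_add, map_sub, map_mul, map_neg, map_pow, map_natCast, map_ofNat, map_one]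
  push_cast
  ring

lemma le_mul_of_preserves (hr : r₁ ≠ r₂)
    (h : PreservesHyperbolicity (secondOrderOp ((X + C r₁) * (X + C r₂))
      (C b * (X + C r₁) + C a * (X + C r₂)) (C R))) : R ≤ a * b := by
  have hd : 0 < (r₂ - r₁) ^ 2 := by
    have := sub_ne_zero.2 hr.symm
    positivity
  have hineq : ∀ m : ℕ, ∀ ε : ℝ, ε = 1 / ((m : ℝ) + 2) →
      ((1 - ε + a * ε) * ((a - b) - 2 * R * ε) + 2 * a * ε * (b + R * ε)) ^ 2 ≤
        (1 - ε + a * ε) ^ 2 * ((a + b) ^ 2 - 4 * R * (1 - ε)) := by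
    intro m ε hε
    have hn : (0 : ℝ) < (m : ℝ) + 2 := by positivity
    -- With c = (m+2)w, the discriminant over (m+2)⁴ is a quadratic in w, nonnegative for every w.
    have hq := discrim_le_zero (a := (a + b) ^ 2 - 4 * R * (1 - ε))
      (b := 2 * (r₂ - r₁) * ((1 - ε + a * ε) * ((a - b) - 2 * R * ε) + 2 * a * ε * (b + R * ε)))
      (c := (r₂ - r₁) ^ 2 * (1 - ε + a * ε) ^ 2) (by
        intro w
        have := discrim_nonneg_of_preserves h m (((m : ℝ) + 2) * w)
        have h2 := div_nonneg this (by positivity : 0 ≤ ((m : ℝ) + 2) ^ 4)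
        refine h2.trans_eq ?_
        rw [hε]
        field_simp
        ring)
    rw [discrim] at hq
    nlinarith [hq, hd]
  have hlim : Filter.Tendsto (fun m : ℕ => 1 / ((m : ℝ) + 2)) Filter.atTop (nhds 0) := by
    simp only [one_div]
    exact Filter.Tendsto.inv_tendsto_atTop
      (Filter.tendsto_atTop_add_const_right _ _ tendsto_natCast_atTop_atTop)
  have hcont : Continuous fun ε : ℝ => (1 - ε + a * ε) ^ 2 * ((a + b) ^ 2 - 4 * R * (1 - ε)) -
      ((1 - ε + a * ε) * ((a - b) - 2 * R * ε) + 2 * a * ε * (b + R * ε)) ^ 2 := by fun_prop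
  -- At ε = 0 the difference equals 4(ab - R).
  have := ge_of_tendsto' ((hcont.tendsto 0).comp hlim)
    (fun m => sub_nonneg.2 (hineq m _ rfl))
  norm_num at this
  nlinarith

lemma secondOrderOp_X_add_C_pow (n : ℕ) :
    secondOrderOp ((X + C r₁) * (X + C r₂)) (C b * (X + C r₁) + C a * (X + C r₂)) (C R)
        ((X + C r₁) ^ n) =
      C (n * (n - 1) + n * (a + b) + R) * (X + C r₁) ^ n +
        C (n * (n - 1 + a) * (r₂ - r₁)) * (X + C r₁) ^ (n - 1) := by
  rw [secondOrderOp_apply]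
  rcases n with _ | _ | n
  · simp
  · simp
    ring
  · simp only [derivative_X_add_C_pow, derivative_mul, derivative_C, Nat.add_sub_cancel]
    push_cast
    simp only [map_add, map_sub, map_mul, map_natCast, map_one]
    ring

lemma nonneg_of_preserves (ha : 0 ≤ a) (hb : 0 ≤ b)
    (h : PreservesHyperbolicity (secondOrderOp ((X + C r₁) * (X + C r₂))
      (C b * (X + C r₁) + C a * (X + C r₂)) (C R))) : 0 ≤ R := by
  by_contra! hR
  let l : ℕ → ℝ := fun n => n * (n - 1) + n * (a + b) + R
  -- j + 1 is the first index with l ≥ 0 (l 0 = R < 0), and l(j+2) - l(j+1) = 2(j+1) + a + b > 0.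
  obtain ⟨j, hj, hj2⟩ : ∃ j, l j < 0 ∧ 0 < l (j + 2) := by
    have hex : ∃ n, 0 ≤ l n := by
      obtain ⟨n, hn⟩ := exists_nat_ge (1 - R)
      refine ⟨n, ?_⟩
      simp only [l]
      have := mul_nonneg (Nat.cast_nonneg (α := ℝ) n) (add_nonneg ha hb)
      nlinarith
    classical
    have hmin := Nat.find_min hex (m := Nat.find hex - 1)
    have hspec := Nat.find_spec hex
    have hpos : Nat.find hex ≠ 0 := by
      intro h0
      rw [h0] at hspec
      simp [l] at hspec
      linarith
    obtain ⟨j, hj⟩ := Nat.exists_eq_succ_of_ne_zero hpos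
    rw [hj] at hmin hspec
    refine ⟨j, not_le.1 (hmin (by simp)), ?_⟩
    simp only [l, Nat.succ_eq_add_one] at hspec ⊢
    push_cast at hspec ⊢
    have := Nat.cast_nonneg (α := ℝ) j
    linarith
  set μ : ℝ := (j + 2 : ℕ) * ((j + 2 : ℕ) - 1 + a) * (r₂ - r₁) with hμ
  set k₂ : ℝ := ((j + 2).descFactorial j : ℝ) with hk₂
  set k₁ : ℝ := ((j + 1).descFactorial j : ℝ) with hk₁
  set k₀ : ℝ := (j.descFactorial j : ℝ) with hk₀
  have hk₂pos : 0 < k₂ := Nat.cast_pos.2 (Nat.descFactorial_pos.2 (by omega))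
  have hk₀pos : 0 < k₀ := Nat.cast_pos.2 (Nat.descFactorial_pos.2 le_rfl)
  -- The j-th derivative of the image is quadratic in x + r₁. Its outer coefficients are both
  -- positive for M ≠ 0, and only the constant one depends on M.
  have hdisc : ∀ M : ℝ, 0 ≤ (μ * k₁) ^ 2 - 4 * (l (j + 2) * k₂) * (-(M ^ 2) * l j * k₀) := by
    intro M
    have hf : IsHyperbolic ((X + C r₁) ^ (j + 2) - M ^ 2 • (X + C r₁) ^ j) := by
      convert ((isHyperbolic_X_add_C r₁).pow j).mul
        ((isHyperbolic_X_add_C (r₁ - M)).mul (isHyperbolic_X_add_C (r₁ + M))) using 1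
      rw [smul_eq_C_mul]
      simp only [map_add, map_sub, map_pow]
      ring
    have hT := (h _ hf).iterate_derivative j
    refine discrim_nonneg_of_isHyperbolic (r := r₁) (one_ne_zero (α := ℝ[X])) ?_
    convert hT using 1
    have hlow : derivative^[j] (C (j * (j - 1 + a) * (r₂ - r₁)) * (X + C r₁) ^ (j - 1)) = 0 := by
      rw [iterate_derivative_C_mul, iterate_derivative_X_add_pow]
      rcases j with _ | j
      · simp
      · simp
    rw [map_sub, map_smul, secondOrderOp_X_add_C_pow, secondOrderOp_X_add_C_pow,
      iterate_derivative_sub, iterate_derivative_smul, iterate_map_add,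
      iterate_map_add, hlow, iterate_derivative_C_mul, iterate_derivative_C_mul,
      iterate_derivative_C_mul, iterate_derivative_X_add_pow, iterate_derivative_X_add_pow,
      iterate_derivative_X_add_pow, ← hμ]
    simp only [l, smul_eq_C_mul, nsmul_eq_mul, show j + 2 - 1 = j + 1 by omega,
      Nat.add_sub_cancel_left, Nat.sub_self, pow_zero, pow_one, map_mul, map_neg, hk₂, hk₁, hk₀,
      map_natCast]
    ring
  have hα : 0 < 4 * (l (j + 2) * k₂) * (-l j * k₀) := by
    have := neg_pos.2 hj
    positivity
  obtain ⟨M, hM⟩ := exists_nat_gt ((μ * k₁) ^ 2 / (4 * (l (j + 2) * k₂) * (-l j * k₀)))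
  rw [div_lt_iff₀ hα] at hM
  have hMsq : (M : ℝ) ≤ (M : ℝ) ^ 2 := by exact_mod_cast Nat.le_self_pow two_ne_zero M
  have := mul_le_mul_of_nonneg_right hMsq hα.le
  have := hdisc M
  linarith

end Necessity

theorem mainTheorem3 (a b r₁ r₂ R : ℝ) (ha : 0 ≤ a) (hb : 0 ≤ b) (hr : r₁ ≠ r₂) :
    R ∈ Set.Icc 0 (a * b) ↔
      PreservesHyperbolicity
        (secondOrderOp ((X + C r₁) * (X + C r₂))
          (C b * (X + C r₁) + C a * (X + C r₂)) (C R)) :=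
  ⟨preservesHyperbolicity_of_mem_Icc r₁ r₂ ha hb,
    fun h => ⟨nonneg_of_preserves ha hb h, le_mul_of_preserves hr h⟩⟩
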